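/- Let $\Lambda\subset\mathbb{R}^d$ be a measurable set of finite positive volume $|\Lambda|$ and let $t\ge 0$. Consider the gas of point particles in $\Lambda$ with the uniformly repulsive pair potential $\phi_\Lambda(t;x)=t/|\Lambda|$. Let $\Xi_\Lambda(z)=\sum_{n\ge 0}\frac{z^n}{n!}\int_{\Lambda^n}e^{-\sum_{1\le i<j\le n}\phi_\Lambda(t;x_i-x_j)}\,dx$ be its grand-canonical partition function (inverse temperature $1$), $\wp(z)=|\Lambda|^{-1}\log\Xi_\Lambda(z)$ its pressure and $\rho(z)=z\wp'(z)$ its density, as formal power series in the activity $z$. The virial series is the formal power series $P(\rho)=\wp(Z(\rho))=\sum_{n\ge1}B_n(t)\rho^n$, where $Z$ is the formal compositional inverse of $\rho(z)$; it exists and is unique. Its radius of convergence $\mathcal{R}_P(t)\in[0,\infty]$ satisfies $$\mathcal{R}_P(t)\ \ge\ \frac{\varkappa}{\lambda},\qquad \varkappa=\frac{2+\sqrt{1-\eta}-2\sqrt{1-\eta/2+\sqrt{1-\eta}}}{1+\eta},\qquad \eta=e^{-t/|\Lambda|},\qquad \lambda=|\Lambda|(1-\eta),$$ where for $t=0$ the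 right-hand side is read as $+\infty$. Moreover, for every $t>0$ this lower bound strictly exceeds the Lebowitz--Penrose bound for nonnegative potentials, $\|e^{-\phi_\Lambda}-1\|_{L^1(\Lambda)}^{-1}\,\max_{0\le w<1}(2e^{-w}-1)w$, as well as $0.144767/\lambda$ (the same bound with its constant rounded to six decimals); and if $0<t/|\Lambda|\le 0.00538$ (that is, $2\varepsilon t\le 0.00538$ with $\varepsilon=1/(2|\Lambda|)$), then it strictly exceeds $0.278465/\lambda$. -/

import Mathlib

open MeasureTheory PowerSeries

noncomputable section

namespace RepulsiveGas

/-- Euclidean space `ℝ^d`. -/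
abbrev E (d : ℕ) := EuclideanSpace ℝ (Fin d)

/-- The uniformly repulsive pair potential `φ_Λ(t; x) = t / |Λ|` between particles of the
container `Λ`. -/
def pairPotential {d : ℕ} (Λ : Set (E d)) (t : ℝ) (_x : E d) : ℝ :=
  t / volume.real Λ

/-- Energy `U(x) = ∑_{i < j} φ(x_i - x_j)` of a configuration of `n` particles. -/
def energy {d n : ℕ} (φ : E d → ℝ) (x : Fin n → E d) : ℝ :=
  ∑ i, ∑ j ∈ Finset.Ioi i, φ (x i - x j)

/-- Canonical partition function `Q_{Λ,n} = (1/n!) ∫_{Λ^n} e^{-U(x)} dx` (with `β = 1`). -/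
def canonicalPartition {d : ℕ} (Λ : Set (E d)) (φ : E d → ℝ) (n : ℕ) : ℝ :=
  ((n.factorial : ℝ))⁻¹ *
    ∫ x in Set.univ.pi (fun _ : Fin n => Λ), Real.exp (-energy φ x)

/-- Grand canonical partition function `Ξ_Λ(z) = ∑_n Q_{Λ,n} z^n`, as a power series in the
activity `z`. -/
def grandPartition {d : ℕ} (Λ : Set (E d)) (φ : E d → ℝ) : PowerSeries ℝ :=
  PowerSeries.mk (canonicalPartition Λ φ)

/-- The Mayer series of the pressure, `℘(z) = |Λ|⁻¹ log Ξ_Λ(z)`. -/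
def mayerSeries {d : ℕ} (Λ : Set (E d)) (φ : E d → ℝ) : PowerSeries ℝ :=
  PowerSeries.C (volume.real Λ)⁻¹ * PowerSeries.logOf (grandPartition Λ φ)

/-- The series of the density, `ρ(z) = z ℘'(z)`. -/
def densitySeries {d : ℕ} (Λ : Set (E d)) (φ : E d → ℝ) : PowerSeries ℝ :=
  PowerSeries.X * PowerSeries.derivative ℝ (mayerSeries Λ φ)

/-- `P` is the virial series: `P(ρ) = ℘(Z(ρ))`, where `Z` is the formal power series without
constant term that solves `z ℘'(z) = ρ` for `z`. -/
def IsVirialSeries {d : ℕ} (Λ : Set (E d)) (φ : E d → ℝ) (P : PowerSeries ℝ) : Prop :=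
  ∃ Z : PowerSeries ℝ, PowerSeries.constantCoeff Z = 0 ∧
    (densitySeries Λ φ).subst Z = PowerSeries.X ∧ P = (mayerSeries Λ φ).subst Z

/-- Radius of convergence of `∑_n B_n ρ^n` in the complex variable `ρ`. -/
def radiusOfConvergence (P : PowerSeries ℝ) : ENNReal :=
  (FormalMultilinearSeries.ofScalars ℂ (fun n => ((PowerSeries.coeff n P : ℝ) : ℂ))).radius

/-- `η = e^{-t/|Λ|}`, with `V = |Λ|`. -/
def eta (V t : ℝ) : ℝ := Real.exp (-(t / V))

/-- `λ = |Λ| (1 - η)`, with `V = |Λ|`. -/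
def lam (V t : ℝ) : ℝ := V * (1 - eta V t)

/-- The prefactor `ϰ` as a function of `η`. -/
def varkappa (η : ℝ) : ℝ :=
  (2 + Real.sqrt (1 - η) - 2 * Real.sqrt (1 - η / 2 + Real.sqrt (1 - η))) / (1 + η)

/-- The Lebowitz-Penrose lower bound on the radius of convergence of the virial series for a
nonnegative potential: `B⁻¹ max_{0 ≤ w < 1} (2 e^{-w} - 1) w`, where `B = ‖e^{-φ} - 1‖₁`. -/
def lebowitzPenroseBound {d : ℕ} (Λ : Set (E d)) (φ : E d → ℝ) : ℝ :=
  sSup ((fun w : ℝ => (2 * Real.exp (-w) - 1) * w) '' Set.Ico 0 1) /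
    ∫ y in Λ, |Real.exp (-φ y) - 1|

end RepulsiveGas

end

/-! The energy of `n` particles is a constant multiple of `n.choose 2`, so `Ξ(z) = ∑ Vⁿ η^(n choose
2) zⁿ / n!`. In the variable `s = t / V` it solves the heat-type equation `2 ∂ₛΞ = -z² Ξ''`. Its
logarithmic derivative, which is `V ρ(z)`, therefore solves a Burgers equation, and inverting `ρ(z)`
turns this into an equation for `u = P'`, which equals `ρ Z'(ρ) / Z(ρ)`: `2 ∂ₛu = ρ ((ρ / u)'' +
2V)`, with `u = 1` for the ideal gas `s = 0`.

Put `ξ = u - 1` and `1 / u = 1 - ξ + S`, so that `S = ξ (ξ - S)`. Coefficientwise, `2 ∂ₛξₙ + n(n+1)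
ξₙ = n(n+1) Sₙ + 2V [n = 1]`: a damped linear equation whose source involves only lower
coefficients. An explicit supersolution dominates it by induction on `n`
(`virial_coeff_le_majorant`). The generating function of the supersolution solves a quadratic
equation whose discriminant vanishes at `x = ϰ`, which bounds its coefficients by a multiple of
`ϰ⁻ⁿ` (`majorant_mul_varkappa_pow_le`). The factor `(V(1 - η))ⁿ = λⁿ` then gives the radius `ϰ / λ`.

All series have coefficients in `ℝ[y]`, `y = 1 - η`, where `∂ₛ` is the derivation `(1 - y) d/dy`;
the flow is thus purely algebraic, and `y` is specialised only for the estimates. -/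

noncomputable section

namespace RepulsiveGas

open Finset.HasAntidiagonal (antidiagonal)

/-! ### Evolution equations for the density, its inverse and the virial series -/

section FormalIdentities

variable {A : Type*} [CommRing A]

theorem coeff_pow_eq_zero_of_lt {Z : A⟦X⟧} (hZ : constantCoeff Z = 0) {n d : ℕ} (h : n < d) :
    coeff n (Z ^ d) = 0 :=
  X_pow_dvd_iff.1 (pow_dvd_pow_of_dvd (X_dvd_iff.2 hZ) d) n h

theorem coeff_subst_eq_sum {Z : A⟦X⟧} (hZ : constantCoeff Z = 0) (f : A⟦X⟧) {n N : ℕ}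
    (h : n < N) :
    coeff n (f.subst Z) = coeff n (∑ d ∈ Finset.range N, C (coeff d f) * Z ^ d) := by
  rw [coeff_subst' (HasSubst.of_constantCoeff_zero' hZ),
    finsum_eq_sum_of_support_subset (s := Finset.range N)]
  · simp [map_sum]
  · intro d hd
    by_contra hdN
    have hdN : N ≤ d := by simpa using hdN
    exact hd (by simp [coeff_pow_eq_zero_of_lt hZ (h.trans_le hdN)])

/-- The derivative of the virial series: the solution `u` of `X Z' = u Z`. -/
theorem exists_virialDerivative {Z : A⟦X⟧} (hZ : constantCoeff Z = 0)
    (hZ1 : IsUnit (coeff 1 Z)) :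
    ∃ u k : A⟦X⟧, X * d⁄dX A Z = u * Z ∧ u * k = 1 := by
  obtain ⟨E, rfl⟩ := X_dvd_iff.2 hZ
  have hE : IsUnit E := by
    rw [isUnit_iff_constantCoeff]
    rwa [← zero_add 1, coeff_succ_X_mul, coeff_zero_eq_constantCoeff_apply] at hZ1
  have hZ' : IsUnit (d⁄dX A (X * E)) := by
    rw [isUnit_iff_constantCoeff, ← coeff_zero_eq_constantCoeff_apply, coeff_derivative]
    simpa using hZ1
  obtain ⟨e, rfl⟩ := hE
  obtain ⟨w, hw⟩ := hZ'
  refine ⟨w * ↑e⁻¹, e * ↑w⁻¹, ?_, ?_⟩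
  · rw [← hw]
    linear_combination (-(X * (w : A⟦X⟧))) * e.inv_mul
  · linear_combination (w * (w⁻¹ : A⟦X⟧ˣ) : A⟦X⟧) * e.inv_mul + w.mul_inv

variable [Algebra ℝ A]

/-- The derivation of `A⟦X⟧` that applies a derivation of `A` to every coefficient. -/
def coeffDerivation (δ : Derivation ℝ A A) : Derivation ℝ A⟦X⟧ A⟦X⟧ where
  toFun f := PowerSeries.mk fun n => δ (coeff n f)
  map_add' f g := by ext n; simp
  map_smul' c f := by ext n; simp
  map_one_eq_zero' := by
    ext n
    by_cases hn : n = 0 <;> simp [coeff_one, hn]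
  leibniz' f g := by
    ext n
    simp only [LinearMap.coe_mk, AddHom.coe_mk, coeff_mk, smul_eq_mul, coeff_mul, map_sum,
      Derivation.leibniz, map_add, Finset.sum_add_distrib]
    rw [add_right_inj]
    exact Finset.Nat.sum_antidiagonal_swap (f := fun p => coeff p.1 g * δ (coeff p.2 f))

@[simp]
theorem coeff_coeffDerivation (δ : Derivation ℝ A A) (f : A⟦X⟧) (n : ℕ) :
    coeff n (coeffDerivation δ f) = δ (coeff n f) :=
  coeff_mk n fun n => δ (coeff n f)

theorem coeffDerivation_C (δ : Derivation ℝ A A) (a : A) :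
    coeffDerivation δ (C a) = C (δ a) := by
  ext n
  by_cases hn : n = 0 <;> simp [coeff_C, hn]

theorem coeffDerivation_X (δ : Derivation ℝ A A) : coeffDerivation δ (X : A⟦X⟧) = 0 := by
  ext n
  by_cases hn : n = 1 <;> simp [coeff_X, hn]

theorem coeffDerivation_derivative (δ : Derivation ℝ A A) (f : A⟦X⟧) :
    coeffDerivation δ (d⁄dX A f) = d⁄dX A (coeffDerivation δ f) := by
  ext n
  simp only [coeff_coeffDerivation, coeff_derivative, Derivation.leibniz, smul_eq_mul, map_add,
    Derivation.map_natCast, Derivation.map_one_eq_zero]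
  ring

/-- Chain rule when both series depend on the parameter. Since `Z` has no constant term, each
coefficient sees only a finite sum of powers of `Z`, to which the Leibniz rule applies. -/
theorem coeffDerivation_subst (δ : Derivation ℝ A A) {Z : A⟦X⟧} (hZ : constantCoeff Z = 0)
    (f : A⟦X⟧) :
    coeffDerivation δ (f.subst Z) =
      (coeffDerivation δ f).subst Z + (d⁄dX A f).subst Z * coeffDerivation δ Z := by
  ext n
  have hder : ∀ i ≤ n, coeff i ((d⁄dX A f).subst Z) =
      coeff i (∑ d ∈ Finset.range (n + 2), C (coeff d f) * ((d : A⟦X⟧) * Z ^ (d - 1))) := by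
    intro i hi
    rw [coeff_subst_eq_sum hZ _ (Nat.lt_succ_of_le hi), Finset.sum_range_succ' _ (n + 1)]
    simp only [Nat.cast_zero, zero_mul, mul_zero, add_zero, Nat.add_sub_cancel, coeff_derivative]
    congr 1
    refine Finset.sum_congr rfl fun d _ => ?_
    simp only [map_mul, map_add, map_natCast, map_one]
    push_cast
    ring
  have hmul : coeff n ((d⁄dX A f).subst Z * coeffDerivation δ Z) =
      coeff n ((∑ d ∈ Finset.range (n + 2), C (coeff d f) * ((d : A⟦X⟧) * Z ^ (d - 1))) *
        coeffDerivation δ Z) := by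
    rw [coeff_mul, coeff_mul]
    exact Finset.sum_congr rfl fun p hp => by
      rw [hder p.1 (Finset.HasAntidiagonal.antidiagonal.fst_le hp)]
  rw [coeff_coeffDerivation, coeff_subst_eq_sum hZ f (show n < n + 2 by omega),
    ← coeff_coeffDerivation, map_add, coeff_subst_eq_sum hZ _ (show n < n + 2 by omega), hmul,
    ← map_add]
  congr 1
  rw [map_sum, Finset.sum_mul, ← Finset.sum_add_distrib]
  refine Finset.sum_congr rfl fun d _ => ?_
  rw [Derivation.leibniz, Derivation.leibniz_pow, coeffDerivation_C, coeff_coeffDerivation]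
  simp only [smul_eq_mul, nsmul_eq_mul]
  ring

variable [IsDomain A]

/-- If `2 δF = -X² F''` and `v ρ = X F' / F`, then `2 δρ = -D (D ρ + v ρ² - ρ)`, where
`D = X d/dX`. -/
theorem two_mul_coeffDerivation_density (δ : Derivation ℝ A A) {F ρ v : A⟦X⟧} (hF : F ≠ 0)
    (hv : v ≠ 0) (hδv : coeffDerivation δ v = 0) (hv' : d⁄dX A v = 0)
    (hδF : 2 * coeffDerivation δ F = -(X ^ 2 * d⁄dX A (d⁄dX A F)))
    (hρ : v * ρ * F = X * d⁄dX A F) :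
    2 * coeffDerivation δ ρ =
      -(X * d⁄dX A (X * d⁄dX A ρ + v * ρ ^ 2 - ρ)) := by
  have hδX : coeffDerivation δ (X : A⟦X⟧) = 0 := coeffDerivation_X δ
  -- `X² F'' = D²F - DF`, and `DF = vρF` makes this a multiple `K` of `F`. As `δ` and `D` commute,
  -- `2 δ(vρ) = D(2 δF / F) = -DK`; the rest is this computation with denominators cleared.
  have h1 : X ^ 2 * d⁄dX A (d⁄dX A F) = (X * (v * d⁄dX A ρ) + (v * ρ) ^ 2 - v * ρ) * F := by
    have h := congrArg (fun f => X * d⁄dX A f) hρ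
    simp only [Derivation.leibniz, smul_eq_mul, derivative_X, hv'] at h
    linear_combination hρ - v * ρ * hρ - h
  set K := X * (v * d⁄dX A ρ) + (v * ρ) ^ 2 - v * ρ with hK
  have h2 : 2 * coeffDerivation δ F = -(K * F) := by rw [hδF, h1]
  have h3 := congrArg (fun f => X * d⁄dX A f) h2
  have h4 := congrArg (coeffDerivation δ) hρ
  have h2' : d⁄dX A (2 : A⟦X⟧) = 0 := by simpa using (d⁄dX A).map_natCast 2
  simp only [Derivation.leibniz, smul_eq_mul, map_neg, hδv, hδX, h2', mul_zero, add_zero,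
    coeffDerivation_derivative] at h3 h4
  have hK' : v * d⁄dX A (X * d⁄dX A ρ + v * ρ ^ 2 - ρ) = d⁄dX A K := by
    have : K = v * (X * d⁄dX A ρ + v * ρ ^ 2 - ρ) := by rw [hK]; ring
    rw [this, Derivation.leibniz, hv']
    simp
  have h5 : (v * F) * (2 * coeffDerivation δ ρ) =
      (v * F) * -(X * d⁄dX A (X * d⁄dX A ρ + v * ρ ^ 2 - ρ)) := by
    linear_combination 2 * h4 + h3 + X * F * hK' - v * ρ * h2 + K * hρ
  exact mul_left_cancel₀ (mul_ne_zero hv hF) h5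

/-- The evolution equation of the derivative `u` of the virial series: with `k = 1 / u`,
`2 δu = X ((X k)'' + 2 v)`. -/
theorem two_mul_coeffDerivation_virialDerivative (δ : Derivation ℝ A A) {ρ Z u k v : A⟦X⟧}
    (hZ : constantCoeff Z = 0) (hsub : ρ.subst Z = X)
    (hv' : d⁄dX A v = 0) (hvs : v.subst Z = v)
    (hδρ : 2 * coeffDerivation δ ρ = -(X * d⁄dX A (X * d⁄dX A ρ + v * ρ ^ 2 - ρ)))
    (hu : X * d⁄dX A Z = u * Z) (huk : u * k = 1) :
    2 * coeffDerivation δ u = X * (d⁄dX A (d⁄dX A (X * k)) + 2 * v) := by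
  have hs : HasSubst Z := HasSubst.of_constantCoeff_zero' hZ
  have h2' : d⁄dX A (2 : A⟦X⟧) = 0 := by simpa using (d⁄dX A).map_natCast 2
  have hδX : coeffDerivation δ (X : A⟦X⟧) = 0 := coeffDerivation_X δ
  have hZρ : (d⁄dX A ρ).subst Z * d⁄dX A Z = 1 := by
    rw [← derivative_subst hs, hsub, derivative_X]
  have hZ'0 : d⁄dX A Z ≠ 0 := fun h => by simp [h] at hZρ
  have hZ0 : Z ≠ 0 := fun h => by simp [h] at hZρ
  have hchain : (coeffDerivation δ ρ).subst Z + (d⁄dX A ρ).subst Z * coeffDerivation δ Z = 0 := by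
    rw [← coeffDerivation_subst δ hZ, hsub, hδX]
  -- `ρ'(Z) = 1 / Z'`, so `Z ρ'(Z) = Z / Z' = X / u`.
  have hΘ : (X * d⁄dX A ρ).subst Z = X * k := by
    rw [subst_mul hs, subst_X hs]
    refine mul_right_cancel₀ hZ'0 ?_
    linear_combination Z * hZρ - k * hu - Z * huk
  set K := X * d⁄dX A ρ + v * ρ ^ 2 - ρ with hK
  have hKs : K.subst Z = X * k + v * X ^ 2 - X := by
    rw [hK, subst_sub hs, subst_add hs, hΘ, subst_mul hs, subst_pow hs, hvs, hsub]
  set W := d⁄dX A (X * k + v * X ^ 2 - X) with hW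
  have hKZ : (d⁄dX A K).subst Z * d⁄dX A Z = W := by
    rw [← derivative_subst hs, hKs]
  have hδρZ : 2 * (coeffDerivation δ ρ).subst Z = -(Z * (d⁄dX A K).subst Z) := by
    have h := congrArg (PowerSeries.subst Z) hδρ
    rw [subst_mul hs, ← neg_one_mul (X * _), subst_mul hs, subst_mul hs, subst_X hs] at h
    have h2 : (2 : A⟦X⟧).subst Z = (2 : A⟦X⟧) := by
      simpa [coe_substAlgHom] using map_ofNat (substAlgHom (R := A) hs) 2
    have h1 : (-1 : A⟦X⟧).subst Z = (-1 : A⟦X⟧) := by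
      rw [← coe_substAlgHom hs, map_neg, map_one]
    rw [h2, h1] at h
    linear_combination h
  -- So `W / 2` is the logarithmic derivative of `Z` in the parameter; applying `D` to it gives
  -- `δu`, because `u = D log Z`.
  have hδZ : 2 * coeffDerivation δ Z = Z * W := by
    linear_combination 2 * d⁄dX A Z * hchain - d⁄dX A Z * hδρZ + Z * hKZ
      - 2 * coeffDerivation δ Z * hZρ
  have h3 := congrArg (coeffDerivation δ) hu
  have h4 := congrArg (d⁄dX A) hδZ
  simp only [Derivation.leibniz, smul_eq_mul, hδX, h2', mul_zero, add_zero,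
    coeffDerivation_derivative] at h3 h4
  have h5 : Z * (2 * coeffDerivation δ u) = Z * (X * d⁄dX A W) := by
    linear_combination -2 * h3 + X * h4 - u * hδZ + W * hu
  have h6 : d⁄dX A W = d⁄dX A (d⁄dX A (X * k)) + 2 * v := by
    have h7 : W = d⁄dX A (X * k) + 2 * v * X - 1 := by
      rw [hW, map_sub, map_add, Derivation.leibniz _ v, Derivation.leibniz_pow, hv', derivative_X]
      simp only [smul_eq_mul, nsmul_eq_mul, Nat.cast_ofNat]
      ring
    rw [h7, map_sub, map_add, Derivation.leibniz _ (2 * v), Derivation.leibniz _ 2, hv', h2',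
      derivative_X, Derivation.map_one_eq_zero]
    simp only [smul_eq_mul]
    ring
  rw [mul_left_cancel₀ hZ0 h5, h6]

end FormalIdentities

/-! ### The majorant as a supersolution of the coefficient equations -/

section Majorant

/-- The coefficients `μₙ` of the majorant, polynomials in `y = 1 - η`. Their generating function
`μ` solves `μ = y x² + 3 x μ + μ (2 μ + (1 - y) x² / (1 - x))`. -/
def majorant (n : ℕ) : Polynomial ℝ :=
  if n = 0 then 0 else if n = 2 then Polynomial.X else
    3 * majorant (n - 1) + ∑ p ∈ (antidiagonal n).attach,
      if h : 2 ≤ p.1.1 ∧ 2 ≤ p.1.2 then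
        majorant p.1.1 * (2 * majorant p.1.2 + (1 - Polynomial.X)) else 0
termination_by n
decreasing_by
  · omega
  · have := Finset.HasAntidiagonal.mem_antidiagonal.1 p.2; omega
  · have := Finset.HasAntidiagonal.mem_antidiagonal.1 p.2; omega

theorem majorant_zero : majorant 0 = 0 := by
  rw [majorant, if_pos rfl]

theorem majorant_eq {n : ℕ} (h0 : n ≠ 0) (h2 : n ≠ 2) :
    majorant n = 3 * majorant (n - 1) + ∑ p ∈ antidiagonal n,
      if 2 ≤ p.1 ∧ 2 ≤ p.2 then
        majorant p.1 * (2 * majorant p.2 + (1 - Polynomial.X)) else 0 := by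
  rw [majorant, if_neg h0, if_neg h2, ← Finset.sum_attach (antidiagonal n)]
  simp only [dite_eq_ite]

theorem majorant_one : majorant 1 = 0 := by
  rw [majorant_eq one_ne_zero (by norm_num), Nat.sub_self, majorant_zero, mul_zero, zero_add]
  refine Finset.sum_eq_zero fun p hp => if_neg fun h => ?_
  have := Finset.HasAntidiagonal.mem_antidiagonal.1 hp
  omega

theorem majorant_two : majorant 2 = Polynomial.X := by
  rw [majorant, if_neg two_ne_zero, if_pos rfl]

/-- The coefficients of `(1 - y) x² / (1 - x)`. -/
def majorantTail (n : ℕ) : Polynomial ℝ := if 2 ≤ n then 1 - Polynomial.X else 0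

theorem majorant_eq_sum (n : ℕ) :
    majorant n = (if n = 2 then Polynomial.X else 0) + 3 * majorant (n - 1) +
      ∑ p ∈ antidiagonal n, majorant p.1 * (2 * majorant p.2 + majorantTail p.2) := by
  have hterm : ∀ p : ℕ × ℕ, majorant p.1 * (2 * majorant p.2 + majorantTail p.2) =
      if 2 ≤ p.1 ∧ 2 ≤ p.2 then
        majorant p.1 * (2 * majorant p.2 + (1 - Polynomial.X)) else 0 := by
    rintro ⟨i, j⟩
    have hsmall : ∀ i < 2, majorant i = 0 := fun i hi => by
      interval_cases i
      exacts [majorant_zero, majorant_one]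
    by_cases hi : 2 ≤ i <;> by_cases hj : 2 ≤ j
    · simp [majorantTail, hi, hj]
    · simp [majorantTail, hj, hsmall j (by omega)]
    · simp [hi, hsmall i (by omega)]
    · simp [hi, hsmall i (by omega)]
  rw [Finset.sum_congr rfl fun p _ => hterm p]
  rcases eq_or_ne n 0 with rfl | h0
  · simp [majorant_zero]
  rcases eq_or_ne n 2 with rfl | h2
  · rw [majorant_two, if_pos rfl, majorant_one, mul_zero, add_zero, Finset.sum_eq_zero, add_zero]
    intro p hp
    have := Finset.HasAntidiagonal.mem_antidiagonal.1 hp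
    exact if_neg fun h => by omega
  · rw [if_neg h2, zero_add, majorant_eq h0 h2]

/-- The majorant of the coefficients of `u - 1`. -/
def virialMajorant (n : ℕ) : Polynomial ℝ := majorant n + if n = 1 then 1 else 0

/-- The majorant of the nonlinear source. -/
def sourceMajorant (n : ℕ) : Polynomial ℝ := majorant n + majorantTail n

/-- This is `S = ξ (ξ - S)` with the minus sign made a plus, as absolute values require. Written
with generating functions, it is equivalent to the quadratic equation of `μ`. -/
theorem sum_virialMajorant (n : ℕ) :
    ∑ p ∈ antidiagonal n,
      virialMajorant p.1 * (virialMajorant p.2 + sourceMajorant p.2) = sourceMajorant n := by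
  set μ : (Polynomial ℝ)⟦X⟧ := PowerSeries.mk majorant with hμ
  set e : (Polynomial ℝ)⟦X⟧ := PowerSeries.mk majorantTail with he
  set y : (Polynomial ℝ)⟦X⟧ := C Polynomial.X with hy
  have hm : PowerSeries.mk virialMajorant = μ + X := by
    ext1 n
    simp [hμ, virialMajorant, coeff_X]
  have hσ : PowerSeries.mk sourceMajorant = μ + e := by
    ext1 n
    simp [hμ, he, sourceMajorant]
  have hetail : e = (1 - y) * X ^ 2 + X * e := by
    have h1y : (1 : (Polynomial ℝ)⟦X⟧) - y = C (1 - Polynomial.X) := by simp [hy]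
    rw [h1y]
    ext1 n
    rw [map_add, coeff_C_mul, coeff_X_pow]
    rcases n with _ | n
    · simp [he, majorantTail]
    · rw [coeff_succ_X_mul]
      rcases n with _ | _ | n <;> simp [he, majorantTail]
  have hμeq : μ = y * X ^ 2 + 3 * (X * μ) + μ * (2 * μ + e) := by
    ext1 n
    have h3 : (3 : (Polynomial ℝ)⟦X⟧) = C 3 := (map_ofNat C 3).symm
    have h2 : (2 : (Polynomial ℝ)⟦X⟧) = C 2 := (map_ofNat C 2).symm
    rw [h3, h2, map_add, map_add, coeff_C_mul, coeff_C_mul, coeff_X_pow, coeff_mul n μ]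
    simp only [map_add, coeff_C_mul, hμ, he, coeff_mk]
    conv_lhs => rw [majorant_eq_sum]
    rcases n with _ | n
    · simp [majorant_zero]
    · rw [coeff_succ_X_mul]
      simp
  have key : (μ + X) * ((μ + X) + (μ + e)) = μ + e := by
    linear_combination -hμeq - hetail
  have h := congrArg (coeff n) key
  rw [← hσ, ← hm, coeff_mul] at h
  simpa using h

/-- The two lower bounds are what the supersolution inequality needs. They follow by induction from
the linear term `3 * majorant (n - 1)` alone, once the convolution is known to be nonnegative and
nondecreasing in `y`. -/
theorem majorant_bounds {y : ℝ} (h0 : 0 ≤ y) (h1 : y ≤ 1) (n : ℕ) :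
    (0 ≤ (majorant n).eval y ∧ 0 ≤ (majorant n).derivative.eval y) ∧
      (2 ≤ n → ((n : ℝ) - 1) * y ≤ (majorant n).eval y ∧
        1 ≤ (majorant n).derivative.eval y) := by
  induction n using Nat.strong_induction_on with
  | _ n ih =>
  rcases lt_or_ge n 3 with hn | hn
  · interval_cases n
    · simp [majorant_zero]
    · simp [majorant_one]
    · rw [majorant_two]
      norm_num [h0]
  have hval : 0 ≤ ∑ p ∈ antidiagonal n, (if 2 ≤ p.1 ∧ 2 ≤ p.2 then
      majorant p.1 * (2 * majorant p.2 + (1 - Polynomial.X)) else 0 : Polynomial ℝ).eval y := by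
    refine Finset.sum_nonneg fun p hp => ?_
    split_ifs with h
    · have hp := Finset.HasAntidiagonal.mem_antidiagonal.1 hp
      have hi := ((ih p.1 (by omega)).1).1
      have hj := ((ih p.2 (by omega)).1).1
      simp only [Polynomial.eval_mul, Polynomial.eval_add, Polynomial.eval_sub,
        Polynomial.eval_one, Polynomial.eval_X, Polynomial.eval_ofNat]
      have : 0 ≤ 1 - y := by linarith
      positivity
    · simp
  have hder : 0 ≤ ∑ p ∈ antidiagonal n, (Polynomial.derivative (if 2 ≤ p.1 ∧ 2 ≤ p.2 then
      majorant p.1 * (2 * majorant p.2 + (1 - Polynomial.X)) else 0)).eval y := by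
    refine Finset.sum_nonneg fun p hp => ?_
    split_ifs with h
    · have hp := Finset.HasAntidiagonal.mem_antidiagonal.1 hp
      obtain ⟨hi, hi'⟩ := (ih p.1 (by omega)).1
      have hj := ((ih p.2 (by omega)).1).1
      have hj' := ((ih p.2 (by omega)).2 h.2).2
      simp only [Polynomial.derivative_mul, Polynomial.derivative_add, Polynomial.derivative_sub,
        Polynomial.derivative_one, Polynomial.derivative_X, Polynomial.derivative_ofNat,
        Polynomial.eval_mul, Polynomial.eval_add, Polynomial.eval_sub,
        Polynomial.eval_one, Polynomial.eval_X, Polynomial.eval_ofNat, Polynomial.eval_zero]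
      -- The derivative `-1` of `1 - y` is outweighed by `2 μⱼ' ≥ 2`.
      refine add_nonneg (mul_nonneg hi' (by linarith)) (mul_nonneg hi (by linarith))
    · simp
  obtain ⟨hprev, hprev'⟩ := (ih (n - 1) (by omega)).2 (by omega)
  have hn' : ((n - 1 : ℕ) : ℝ) = n - 1 := by
    rw [Nat.cast_sub (by omega), Nat.cast_one]
  have hn3 : (3 : ℝ) ≤ n := by exact_mod_cast hn
  rw [hn'] at hprev
  have hlow : ((n : ℝ) - 1) * y ≤ (majorant n).eval y := by
    rw [majorant_eq (by omega) (by omega), Polynomial.eval_add, Polynomial.eval_mul,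
      Polynomial.eval_finsetSum, Polynomial.eval_ofNat]
    nlinarith [mul_nonneg (sub_nonneg.2 hn3) h0]
  have hlow' : 1 ≤ (majorant n).derivative.eval y := by
    rw [majorant_eq (by omega) (by omega), Polynomial.derivative_add, Polynomial.eval_add,
      Polynomial.derivative_mul, Polynomial.derivative_ofNat, Polynomial.derivative_sum,
      Polynomial.eval_finsetSum, zero_mul, zero_add, Polynomial.eval_mul, Polynomial.eval_ofNat]
    linarith
  exact ⟨⟨le_trans (mul_nonneg (by linarith) h0) hlow, by linarith⟩, fun _ => ⟨hlow, hlow'⟩⟩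

theorem virialMajorant_eval_nonneg {y : ℝ} (h0 : 0 ≤ y) (h1 : y ≤ 1) (n : ℕ) :
    0 ≤ (virialMajorant n).eval y := by
  have := (majorant_bounds h0 h1 n).1.1
  unfold virialMajorant
  split_ifs <;> simp <;> linarith

theorem sourceMajorant_eval_nonneg {y : ℝ} (h0 : 0 ≤ y) (h1 : y ≤ 1) (n : ℕ) :
    0 ≤ (sourceMajorant n).eval y := by
  have := (majorant_bounds h0 h1 n).1.1
  unfold sourceMajorant majorantTail
  split_ifs <;> simp <;> linarith

/-- The majorant is a supersolution of the evolution equation. -/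
theorem virialMajorant_supersolution {V y : ℝ} (hV : 0 ≤ V) (h0 : 0 ≤ y) (h1 : y ≤ 1) {n : ℕ}
    (hn : 1 ≤ n) :
    (n : ℝ) * (n + 1) * ((V * y) ^ n * (sourceMajorant n).eval y) +
        (if n = 1 then 2 * V else 0) ≤
      2 * (1 - y) * (Polynomial.C V ^ n * Polynomial.X ^ n * virialMajorant n).derivative.eval y +
        n * (n + 1) * ((V * y) ^ n * (virialMajorant n).eval y) := by
  rcases eq_or_lt_of_le hn with rfl | hn
  · simp [virialMajorant, sourceMajorant, majorant_one, majorantTail]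
    linarith
  obtain ⟨n, rfl⟩ : ∃ k, n = k + 2 := ⟨n - 2, by omega⟩
  obtain ⟨hlow, hlow'⟩ := (majorant_bounds h0 h1 (n + 2)).2 (by omega)
  have hm : virialMajorant (n + 2) = majorant (n + 2) := by simp [virialMajorant]
  have hσ : (sourceMajorant (n + 2)).eval y = (majorant (n + 2)).eval y + (1 - y) := by
    simp [sourceMajorant, majorantTail]
  rw [hm, hσ, if_neg (by omega), ← Polynomial.C_pow, mul_assoc (Polynomial.C _),
    Polynomial.derivative_C_mul, Polynomial.derivative_mul, Polynomial.derivative_X_pow]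
  simp only [Polynomial.eval_mul, Polynomial.eval_add, Polynomial.eval_C, Polynomial.eval_pow,
    Polynomial.eval_X, Nat.add_succ_sub_one]
  push_cast at hlow ⊢
  set a := (majorant (n + 2)).eval y
  set b := (majorant (n + 2)).derivative.eval y
  -- The lower bounds on `a` and `b` leave exactly `n (n + 1) y`, with the shifted index `n`.
  have hfac : 0 ≤ 2 * ((n : ℝ) + 2) * a + 2 * y * b - (n + 2) * (n + 2 + 1) * y := by
    have h2 : y ≤ y * b := le_mul_of_one_le_right h0 hlow'
    have h3 : ((n : ℝ) + 2) * ((n + 2 - 1) * y) ≤ (n + 2) * a :=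
      mul_le_mul_of_nonneg_left hlow (by positivity)
    have h4 : 0 ≤ (n : ℝ) * (n + 1) * y := by positivity
    linarith
  have h5 : 0 ≤ V ^ (n + 2) * y ^ (n + 1) * (1 - y) *
      (2 * ((n : ℝ) + 2) * a + 2 * y * b - (n + 2) * (n + 2 + 1) * y) :=
    mul_nonneg (mul_nonneg (by positivity) (by linarith)) hfac
  rw [mul_pow, show n + 2 = (n + 1) + 1 from rfl, pow_succ y (n + 1)]
  linarith

/-- Polynomials that satisfy `0 ≤ 2 (1 - y) v' + κ v` on `[0, 1)` and start from a nonnegative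
value stay nonnegative. -/
theorem eval_nonneg_of_evolution (v : Polynomial ℝ) (κ : ℝ) (h0 : 0 ≤ v.eval 0)
    (hv : ∀ y, 0 ≤ y → y < 1 → 0 ≤ 2 * (1 - y) * v.derivative.eval y + κ * v.eval y)
    {y : ℝ} (hy0 : 0 ≤ y) (hy1 : y < 1) : 0 ≤ v.eval y := by
  -- Setting `y = 1 - exp (-s)` turns `(1 - y) d/dy` into `d/ds`, and `exp (κ s / 2)` is the
  -- integrating factor.
  have hd : ∀ s : ℝ, HasDerivAt (fun s => Real.exp (κ / 2 * s) * v.eval (1 - Real.exp (-s)))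
      (Real.exp (κ / 2 * s) * (κ / 2) * v.eval (1 - Real.exp (-s)) +
        Real.exp (κ / 2 * s) * (v.derivative.eval (1 - Real.exp (-s)) * Real.exp (-s))) s := by
    intro s
    have h1 : HasDerivAt (fun s : ℝ => Real.exp (κ / 2 * s)) (Real.exp (κ / 2 * s) * (κ / 2)) s := by
      simpa using ((hasDerivAt_id s).const_mul (κ / 2)).exp
    have h2 : HasDerivAt (fun s : ℝ => 1 - Real.exp (-s)) (Real.exp (-s)) s := by
      simpa using ((hasDerivAt_id s).neg.exp).const_sub 1
    exact h1.mul ((v.hasDerivAt _).comp s h2)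
  have hmono : MonotoneOn (fun s : ℝ => Real.exp (κ / 2 * s) * v.eval (1 - Real.exp (-s)))
      (Set.Ici 0) := by
    refine monotoneOn_of_deriv_nonneg (convex_Ici 0)
      (fun s _ => (hd s).continuousAt.continuousWithinAt)
      (fun s _ => (hd s).differentiableAt.differentiableWithinAt) fun s hs => ?_
    rw [interior_Ici] at hs
    rw [(hd s).deriv]
    have h := hv (1 - Real.exp (-s))
      (by linarith [Real.exp_le_one_iff.2 (neg_nonpos.2 (le_of_lt hs))])
      (by linarith [Real.exp_pos (-s)])
    rw [sub_sub_cancel] at h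
    have := mul_nonneg (Real.exp_pos (κ / 2 * s)).le h
    linarith
  have hs : 0 ≤ -Real.log (1 - y) := by
    linarith [Real.log_nonpos (by linarith : 0 ≤ 1 - y) (by linarith)]
  have h := hmono (Set.mem_Ici.2 le_rfl) (Set.mem_Ici.2 hs) hs
  simp only [mul_zero, Real.exp_zero, neg_zero, sub_self, one_mul, neg_neg,
    Real.exp_log (by linarith : 0 < 1 - y), sub_sub_cancel] at h
  exact nonneg_of_mul_nonneg_right (h0.trans h) (Real.exp_pos _)

/-- Strong induction: `ξ` and `S` vanish in degree `0`, so `Sₙ` depends only on lower degrees and is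
bounded through `sum_virialMajorant`. The bound on `ξₙ` is then a comparison principle applied to `M
+ ξₙ` and `M - ξₙ`, which vanish at `y = 0`. -/
theorem virial_coeff_le_majorant {V : ℝ} (hV : 0 ≤ V) {ξ S : (Polynomial ℝ)⟦X⟧}
    (hS : S = ξ * (ξ - S)) (hξ0 : coeff 0 ξ = 0) (hinit : ∀ n, (coeff n ξ).eval 0 = 0)
    (hode : ∀ n : ℕ, 1 ≤ n → 2 * ((1 - Polynomial.X) * (coeff n ξ).derivative) =
      (n : Polynomial ℝ) * ((n : Polynomial ℝ) + 1) * (coeff n S - coeff n ξ) +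
        if n = 1 then 2 * Polynomial.C V else 0) (n : ℕ) :
    ∀ y, 0 ≤ y → y < 1 →
      |(coeff n ξ).eval y| ≤ (V * y) ^ n * (virialMajorant n).eval y ∧
      |(coeff n S).eval y| ≤ (V * y) ^ n * (sourceMajorant n).eval y := by
  have hS0 : coeff 0 S = 0 := by
    rw [hS, coeff_mul]
    simp [hξ0]
  induction n using Nat.strong_induction_on with
  | _ n ih =>
  have hsource : ∀ y, 0 ≤ y → y < 1 →
      |(coeff n S).eval y| ≤ (V * y) ^ n * (sourceMajorant n).eval y := by
    intro y hy0 hy1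
    rw [hS, coeff_mul, Polynomial.eval_finsetSum, ← sum_virialMajorant n,
      Polynomial.eval_finsetSum, Finset.mul_sum]
    refine (Finset.abs_sum_le_sum_abs _ _).trans (Finset.sum_le_sum fun p hp => ?_)
    have hp := Finset.HasAntidiagonal.mem_antidiagonal.1 hp
    have hVy : 0 ≤ V * y := mul_nonneg hV hy0
    have hm := virialMajorant_eval_nonneg hy0 hy1.le
    have hσ := sourceMajorant_eval_nonneg hy0 hy1.le
    have hR : 0 ≤ (V * y) ^ n * (virialMajorant p.1 *
        (virialMajorant p.2 + sourceMajorant p.2)).eval y := by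
      rw [Polynomial.eval_mul, Polynomial.eval_add]
      exact mul_nonneg (pow_nonneg hVy n) (mul_nonneg (hm _) (add_nonneg (hm _) (hσ _)))
    rcases Nat.eq_zero_or_pos p.1 with h1 | h1
    · rw [h1, hξ0, zero_mul, Polynomial.eval_zero, abs_zero, ← h1]
      exact hR
    rcases Nat.eq_zero_or_pos p.2 with h2 | h2
    · rw [map_sub, h2, hξ0, hS0, sub_zero, mul_zero, Polynomial.eval_zero, abs_zero, ← h2]
      exact hR
    obtain ⟨hi, -⟩ := ih p.1 (by omega) y hy0 hy1
    obtain ⟨hj, hj'⟩ := ih p.2 (by omega) y hy0 hy1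
    rw [map_sub, Polynomial.eval_mul, Polynomial.eval_sub, abs_mul, Polynomial.eval_mul,
      Polynomial.eval_add, ← hp, pow_add]
    calc |(coeff p.1 ξ).eval y| * |(coeff p.2 ξ).eval y - (coeff p.2 S).eval y|
        ≤ ((V * y) ^ p.1 * (virialMajorant p.1).eval y) *
          ((V * y) ^ p.2 * (virialMajorant p.2).eval y +
            (V * y) ^ p.2 * (sourceMajorant p.2).eval y) :=
          mul_le_mul hi ((abs_sub _ _).trans (add_le_add hj hj')) (abs_nonneg _)
            (mul_nonneg (pow_nonneg hVy _) (hm _))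
      _ = _ := by ring
  intro y hy0 hy1
  refine ⟨?_, hsource y hy0 hy1⟩
  rcases Nat.eq_zero_or_pos n with rfl | hn
  · rw [hξ0]
    simpa using virialMajorant_eval_nonneg hy0 hy1.le 0
  set M : Polynomial ℝ := Polynomial.C V ^ n * Polynomial.X ^ n * virialMajorant n with hM
  have hMeval : ∀ y, M.eval y = (V * y) ^ n * (virialMajorant n).eval y := by
    intro y
    simp [hM, mul_pow]
  have hM0 : M.eval 0 = 0 := by
    rw [hMeval, mul_zero, zero_pow hn.ne', zero_mul]
  have hode' : ∀ y, 2 * (1 - y) * (coeff n ξ).derivative.eval y =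
      (n : ℝ) * (n + 1) * ((coeff n S).eval y - (coeff n ξ).eval y) +
        if n = 1 then 2 * V else 0 := by
    intro y
    have h := congrArg (Polynomial.eval y) (hode n hn)
    simp only [Polynomial.eval_mul, Polynomial.eval_add, Polynomial.eval_sub,
      Polynomial.eval_one, Polynomial.eval_X, Polynomial.eval_ofNat, Polynomial.eval_natCast] at h
    rw [mul_assoc, h]
    split_ifs <;> simp
  have hif : 0 ≤ (if n = 1 then 2 * V else 0) := by split_ifs <;> linarith
  rw [← hMeval, abs_le]
  constructor
  · have h := eval_nonneg_of_evolution (M + coeff n ξ) (n * (n + 1))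
      (by simp [hM0, hinit]) (fun z hz0 hz1 => ?_) hy0 hy1
    · rw [Polynomial.eval_add] at h
      linarith
    · have h1 := virialMajorant_supersolution hV hz0 hz1.le hn
      have h2 := mul_le_mul_of_nonneg_left (neg_abs_le ((coeff n S).eval z))
        (by positivity : (0 : ℝ) ≤ n * (n + 1))
      have h3 := mul_le_mul_of_nonneg_left (hsource z hz0 hz1)
        (by positivity : (0 : ℝ) ≤ n * (n + 1))
      rw [← hM, ← hMeval] at h1
      rw [Polynomial.derivative_add, Polynomial.eval_add, Polynomial.eval_add]
      linarith [hode' z]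
  · have h := eval_nonneg_of_evolution (M - coeff n ξ) (n * (n + 1))
      (by simp [hM0, hinit]) (fun z hz0 hz1 => ?_) hy0 hy1
    · rw [Polynomial.eval_sub] at h
      linarith
    · have h1 := virialMajorant_supersolution hV hz0 hz1.le hn
      have h2 := mul_le_mul_of_nonneg_left (le_abs_self ((coeff n S).eval z))
        (by positivity : (0 : ℝ) ≤ n * (n + 1))
      have h3 := mul_le_mul_of_nonneg_left (hsource z hz0 hz1)
        (by positivity : (0 : ℝ) ≤ n * (n + 1))
      rw [← hM, ← hMeval] at h1
      rw [Polynomial.derivative_sub, Polynomial.eval_sub, Polynomial.eval_sub]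
      linarith [hode' z]

end Majorant

/-! ### Growth of the majorant and the constant `ϰ` -/

section Growth

/-- Because `f 0 = g 0 = 0`, a product of total degree at most `N` uses only indices below `N`. This
gain of one degree drives the induction in `sum_majorant_le`. -/
theorem sum_range_antidiagonal_le {f g : ℕ → ℝ} (hf : ∀ n, 0 ≤ f n) (hg : ∀ n, 0 ≤ g n)
    (hf0 : f 0 = 0) (hg0 : g 0 = 0) (N : ℕ) :
    ∑ n ∈ Finset.range (N + 1), ∑ p ∈ antidiagonal n, f p.1 * g p.2 ≤
      (∑ n ∈ Finset.range N, f n) * ∑ n ∈ Finset.range N, g n := by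
  have hdisj : Set.PairwiseDisjoint (Finset.range (N + 1) : Set ℕ)
      (fun n => antidiagonal n) := by
    intro i _ j _ hij
    refine Finset.disjoint_left.2 fun p hp hp' => hij ?_
    rw [← Finset.HasAntidiagonal.mem_antidiagonal.1 hp,
      Finset.HasAntidiagonal.mem_antidiagonal.1 hp']
  rw [Finset.sum_mul_sum, ← Finset.sum_product', ← Finset.sum_biUnion hdisj,
    ← Finset.sum_filter_ne_zero]
  refine Finset.sum_le_sum_of_subset_of_nonneg (fun p hp => ?_)
    fun p _ _ => mul_nonneg (hf _) (hg _)
  obtain ⟨hp, hne⟩ := Finset.mem_filter.1 hp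
  obtain ⟨n, hn, hp⟩ := Finset.mem_biUnion.1 hp
  have hn := Finset.mem_range.1 hn
  have hp := Finset.HasAntidiagonal.mem_antidiagonal.1 hp
  have h1 : p.1 ≠ 0 := fun h => hne (by simp [h, hf0])
  have h2 : p.2 ≠ 0 := fun h => hne (by simp [h, hg0])
  exact Finset.mem_product.2 ⟨Finset.mem_range.2 (by omega), Finset.mem_range.2 (by omega)⟩

theorem sum_range_sq_geometric_le {x : ℝ} (hx0 : 0 ≤ x) (hx1 : x < 1) (N : ℕ) :
    ∑ n ∈ Finset.range N, (if 2 ≤ n then x ^ n else 0) ≤ x ^ 2 / (1 - x) := by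
  rcases N with _ | _ | N
  · simpa using div_nonneg (sq_nonneg x) (by linarith)
  · simpa using div_nonneg (sq_nonneg x) (by linarith)
  rw [Finset.sum_range_succ', Finset.sum_range_succ', le_div_iff₀ (by linarith)]
  have hsum : ∑ n ∈ Finset.range N, (if 2 ≤ n + 1 + 1 then x ^ (n + 1 + 1) else 0) =
      x ^ 2 * ∑ n ∈ Finset.range N, x ^ n := by
    rw [Finset.mul_sum]
    exact Finset.sum_congr rfl fun n _ => by rw [if_pos (by omega)]; ring
  rw [hsum, if_neg (by norm_num), if_neg (by norm_num), add_zero, add_zero, mul_assoc,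
    geom_sum_mul_neg]
  exact mul_le_of_le_one_right (sq_nonneg x) (by linarith [pow_nonneg hx0 N])

/-- A nonnegative supersolution of the quadratic equation of the generating function bounds its
partial sums. -/
theorem sum_majorant_le {x y s : ℝ} (hx0 : 0 ≤ x) (hx1 : x < 1) (hy0 : 0 ≤ y) (hy1 : y ≤ 1)
    (hs0 : 0 ≤ s)
    (hs : y * x ^ 2 + 3 * x * s + s * (2 * s + (1 - y) * (x ^ 2 / (1 - x))) ≤ s) (N : ℕ) :
    ∑ n ∈ Finset.range N, (majorant n).eval y * x ^ n ≤ s := by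
  induction N with
  | zero => simpa using hs0
  | succ N ih =>
  -- The recursion bounds the longer partial sum by a monotone quadratic map evaluated at a bound
  -- for the shorter one; the supersolution `s` is not increased by this map.
  have ha := fun n => (majorant_bounds hy0 hy1 n).1.1
  have htail : ∀ n, (majorantTail n).eval y * x ^ n = (1 - y) * if 2 ≤ n then x ^ n else 0 := by
    intro n
    unfold majorantTail
    split_ifs <;> simp
  have hf : ∀ n, 0 ≤ (majorant n).eval y * x ^ n := fun n => mul_nonneg (ha n) (pow_nonneg hx0 n)
  have hg : ∀ n, 0 ≤ 2 * ((majorant n).eval y * x ^ n) + (majorantTail n).eval y * x ^ n := by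
    intro n
    rw [htail]
    have h1 : 0 ≤ (if 2 ≤ n then x ^ n else 0) := by
      split_ifs
      exacts [pow_nonneg hx0 n, le_rfl]
    exact add_nonneg (mul_nonneg zero_le_two (hf n)) (mul_nonneg (by linarith) h1)
  have hconv := sum_range_antidiagonal_le hf hg (by simp [majorant_zero])
    (by simp [majorant_zero, majorantTail]) N
  have hsum0 : 0 ≤ ∑ n ∈ Finset.range N, (majorant n).eval y * x ^ n :=
    Finset.sum_nonneg fun n _ => hf n
  have hgsum : ∑ n ∈ Finset.range N,
      (2 * ((majorant n).eval y * x ^ n) + (majorantTail n).eval y * x ^ n) ≤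
        2 * s + (1 - y) * (x ^ 2 / (1 - x)) := by
    rw [Finset.sum_add_distrib, ← Finset.mul_sum, Finset.sum_congr rfl fun n _ => htail n,
      ← Finset.mul_sum]
    exact add_le_add (mul_le_mul_of_nonneg_left ih zero_le_two)
      (mul_le_mul_of_nonneg_left (sum_range_sq_geometric_le hx0 hx1 N) (by linarith))
  have hprod := mul_le_mul ih hgsum (Finset.sum_nonneg fun n _ => hg n) hs0
  have hshift : ∑ n ∈ Finset.range (N + 1), 3 * (majorant (n - 1)).eval y * x ^ n ≤ 3 * x * s := by
    rw [Finset.sum_range_succ', Nat.zero_sub, majorant_zero]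
    simp only [Nat.add_sub_cancel, Polynomial.eval_zero, mul_zero, zero_mul, add_zero]
    rw [Finset.sum_congr rfl fun n _ => show 3 * (majorant n).eval y * x ^ (n + 1) =
      3 * x * ((majorant n).eval y * x ^ n) by ring, ← Finset.mul_sum]
    exact mul_le_mul_of_nonneg_left ih (by positivity)
  have hfirst : ∑ n ∈ Finset.range (N + 1), (if n = 2 then y * x ^ 2 else 0) ≤ y * x ^ 2 := by
    rw [Finset.sum_ite_eq' (Finset.range (N + 1)) 2 (fun _ => y * x ^ 2)]
    split_ifs
    exacts [le_rfl, by positivity]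
  have hterm : ∀ n, (majorant n).eval y * x ^ n = (if n = 2 then y * x ^ 2 else 0) +
      3 * (majorant (n - 1)).eval y * x ^ n + ∑ p ∈ antidiagonal n,
        ((majorant p.1).eval y * x ^ p.1) *
          (2 * ((majorant p.2).eval y * x ^ p.2) + (majorantTail p.2).eval y * x ^ p.2) := by
    intro n
    conv_lhs => rw [majorant_eq_sum]
    rw [Polynomial.eval_add, Polynomial.eval_add, Polynomial.eval_finsetSum, add_mul, add_mul,
      Finset.sum_mul, Polynomial.eval_mul, Polynomial.eval_ofNat]
    congr 1
    · congr 1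
      split_ifs with h
      · simp [h]
      · simp
    · refine Finset.sum_congr rfl fun p hp => ?_
      rw [← Finset.HasAntidiagonal.mem_antidiagonal.1 hp, pow_add]
      simp only [Polynomial.eval_mul, Polynomial.eval_add, Polynomial.eval_ofNat]
      ring
  rw [Finset.sum_congr rfl fun n _ => hterm n, Finset.sum_add_distrib, Finset.sum_add_distrib]
  linarith

/-- The nested root is a perfect square: with `b = √(1 - η)`, `1 - η / 2 + b = (1 + b)² / 2`. -/
theorem varkappa_eq {η : ℝ} (h0 : 0 ≤ η) (h1 : η ≤ 1) :
    varkappa η = (√2 - 1) / (√2 + √(1 - η)) := by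
  unfold varkappa
  set b := √(1 - η) with hb
  have hb0 : 0 ≤ b := Real.sqrt_nonneg _
  have hb2 : b ^ 2 = 1 - η := Real.sq_sqrt (by linarith)
  have hc2 : √2 ^ 2 = (2 : ℝ) := Real.sq_sqrt zero_le_two
  have hc0 : 0 < √2 := Real.sqrt_pos.2 zero_lt_two
  have hroot : √(1 - η / 2 + b) = √2 * (1 + b) / 2 := by
    rw [show 1 - η / 2 + b = (√2 * (1 + b) / 2) ^ 2 by
      linear_combination (-(1 + b) ^ 2 / 4) * hc2 - hb2 / 2]
    exact Real.sqrt_sq (by positivity)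
  rw [hroot, div_eq_div_iff (by linarith) (by positivity)]
  linear_combination (-(1 + b)) * hc2 - (√2 - 1) * hb2

theorem le_varkappa {η : ℝ} (h0 : 0 ≤ η) (h1 : η ≤ 1) : 3 - 2 * √2 ≤ varkappa η := by
  have hc2 : √2 ^ 2 = (2 : ℝ) := Real.sq_sqrt zero_le_two
  have hc1 : 1 ≤ √2 := Real.one_le_sqrt.2 one_le_two
  have hb : √(1 - η) ≤ 1 := Real.sqrt_le_one.2 (by linarith)
  have hb0 := Real.sqrt_nonneg (1 - η)
  rw [varkappa_eq h0 h1, le_div_iff₀ (by linarith)]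
  nlinarith [mul_nonneg (sub_nonneg.2 hb) (sq_nonneg (√2 - 1))]

theorem varkappa_pos {η : ℝ} (h0 : 0 ≤ η) (h1 : η ≤ 1) : 0 < varkappa η := by
  have := le_varkappa h0 h1
  have hc : √2 < 3 / 2 := (Real.sqrt_lt' (by norm_num)).2 (by norm_num)
  linarith

theorem varkappa_lt_one {η : ℝ} (h0 : 0 ≤ η) (h1 : η ≤ 1) : varkappa η < 1 := by
  have hc0 : 0 < √2 := Real.sqrt_pos.2 zero_lt_two
  have hb0 := Real.sqrt_nonneg (1 - η)
  rw [varkappa_eq h0 h1, div_lt_one (by linarith)]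
  linarith

theorem sqrt_two_lt : √2 < 1.41422 := (Real.sqrt_lt' (by norm_num)).2 (by norm_num)

theorem lt_sqrt_two : 1.414213 < √2 := (Real.lt_sqrt (by norm_num)).2 (by norm_num)

theorem majorant_mul_varkappa_pow_le {η : ℝ} (h0 : 0 ≤ η) (h1 : η ≤ 1) (n : ℕ) :
    (majorant n).eval (1 - η) * varkappa η ^ n ≤ 1 := by
  set x := varkappa η with hx
  set b := √(1 - η) with hb
  have hb0 : 0 ≤ b := Real.sqrt_nonneg _
  have hb1 : b ≤ 1 := Real.sqrt_le_one.2 (by linarith)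
  have hb2 : b ^ 2 = 1 - η := Real.sq_sqrt (by linarith)
  have hc2 : √2 ^ 2 = (2 : ℝ) := Real.sq_sqrt zero_le_two
  have hc1 : 1 ≤ √2 := Real.one_le_sqrt.2 one_le_two
  have hx0 : 0 < x := varkappa_pos h0 h1
  have hx1 : x < 1 := varkappa_lt_one h0 h1
  -- This is the vanishing discriminant `1 - 3x - η x² / (1 - x) = 2√2 b x`, multiplied by `1 - x`.
  -- The quadratic then has the double root `√2 b x / 2`, the value used as supersolution.
  have hdisc : 1 - 4 * x + (2 + b ^ 2) * x ^ 2 = 2 * √2 * b * x * (1 - x) := by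
    have hx' : x = (√2 - 1) / (√2 + b) := varkappa_eq h0 h1
    rw [hx']
    have : √2 + b ≠ 0 := by positivity
    field_simp
    linear_combination (-(1 + b) ^ 2) * hc2
  have hsol : (1 - η) * x ^ 2 + 3 * x * (√2 * b * x / 2) + (√2 * b * x / 2) *
      (2 * (√2 * b * x / 2) + (1 - (1 - η)) * (x ^ 2 / (1 - x))) ≤ √2 * b * x / 2 := by
    have hne : 1 - x ≠ 0 := by linarith
    have hq : x ^ 2 / (1 - x) * (1 - x) = x ^ 2 := div_mul_cancel₀ _ hne
    refine le_of_eq (mul_right_cancel₀ hne ?_)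
    rw [← hb2]
    linear_combination (√2 * b * x / 2) * (1 - b ^ 2) * hq - (√2 * b * x / 2) * hdisc -
      b ^ 2 * x ^ 2 * (1 - x) / 2 * hc2
  have hsum := sum_majorant_le hx0.le hx1 (by linarith : 0 ≤ 1 - η) (by linarith)
    (by positivity) hsol (n + 1)
  have hle : (majorant n).eval (1 - η) * x ^ n ≤ √2 * b * x / 2 :=
    (Finset.single_le_sum (f := fun n => (majorant n).eval (1 - η) * x ^ n)
      (fun i _ => mul_nonneg (majorant_bounds (by linarith) (by linarith) i).1.1
        (pow_nonneg hx0.le i)) (Finset.self_mem_range_succ n)).trans hsum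
  have h2 : √2 * b * x ≤ 2 * 1 * 1 := by
    gcongr
    linarith [sqrt_two_lt]
  linarith

theorem virialMajorant_mul_varkappa_pow_le {η : ℝ} (h0 : 0 ≤ η) (h1 : η ≤ 1) (n : ℕ) :
    (virialMajorant n).eval (1 - η) * varkappa η ^ n ≤ 2 := by
  have h := majorant_mul_varkappa_pow_le h0 h1 n
  have hx1 := varkappa_lt_one h0 h1
  rw [virialMajorant, Polynomial.eval_add, add_mul]
  split_ifs with hn
  · subst hn
    simp only [Polynomial.eval_one, pow_one] at h ⊢
    linarith
  · simp only [Polynomial.eval_zero, zero_mul]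
    linarith

end Growth

/-! ### Numerical comparison of the constants -/

section Comparison

/-- The crude value `0.17` suffices, since `varkappa` is at least `3 - 2√2 > 0.171`. -/
theorem lebowitzPenrose_sup_le :
    sSup ((fun w : ℝ => (2 * Real.exp (-w) - 1) * w) '' Set.Ico 0 1) ≤ 0.17 := by
  refine csSup_le ⟨_, Set.mem_image_of_mem _ (Set.left_mem_Ico.2 one_pos)⟩ ?_
  rintro _ ⟨w, ⟨hw0, hw1⟩, rfl⟩
  have h1 := Real.quadratic_le_exp_of_nonneg hw0
  have h2 : Real.exp (-w) ≤ 1 / (1 + w + w ^ 2 / 2) := by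
    rw [Real.exp_neg, ← one_div]
    exact one_div_le_one_div_of_le (by positivity) h1
  have h3 : Real.exp (-w) * w ≤ (w + 0.17) / 2 := by
    refine (mul_le_mul_of_nonneg_right h2 hw0).trans ?_
    rw [one_div_mul_eq_div, div_le_iff₀ (by positivity)]
    nlinarith [sq_nonneg (w - 0.37), mul_nonneg hw0 (sq_nonneg (w - 0.37))]
  change (2 * Real.exp (-w) - 1) * w ≤ 0.17
  linarith

theorem lt_varkappa_of_small {s : ℝ} (hs0 : 0 ≤ s) (hs : s ≤ 0.00538) :
    0.278465 < varkappa (Real.exp (-s)) := by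
  -- The linear bound `1 - s ≤ exp (-s)` is too weak for six decimals; it is applied to `s / 8` and
  -- raised to the eighth power.
  have hη : 1 - 0.005368 ≤ Real.exp (-s) := by
    have h1 : (1 - s / 8) ^ 8 ≤ Real.exp (-s) := by
      have h := Real.add_one_le_exp (-s / 8)
      calc (1 - s / 8) ^ 8 ≤ Real.exp (-s / 8) ^ 8 :=
            pow_le_pow_left₀ (by linarith) (by linarith) 8
        _ = Real.exp (-s) := by
            rw [← Real.exp_nat_mul]
            congr 1
            push_cast
            ring
    have h2 : (1 - 0.00538 / 8 : ℝ) ^ 8 ≤ (1 - s / 8) ^ 8 :=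
      pow_le_pow_left₀ (by norm_num) (by linarith) 8
    refine le_trans ?_ (h2.trans h1)
    norm_num
  have hb : √(1 - Real.exp (-s)) < 0.07327 :=
    (Real.sqrt_lt' (by norm_num)).2 (by norm_num at hη ⊢; linarith)
  have hb0 := Real.sqrt_nonneg (1 - Real.exp (-s))
  have hc := lt_sqrt_two
  rw [varkappa_eq (Real.exp_pos _).le (Real.exp_le_one_iff.2 (by linarith)),
    lt_div_iff₀ (by linarith)]
  linarith

end Comparison

/-! ### The gas over `ℝ[y]` and the bound on its virial coefficients -/

section GasSeries

/-- The grand canonical partition function of the uniformly repulsive gas with `|Λ| = V`, its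
coefficients being polynomials in `y = 1 - η`. -/
def gasSeries (V : ℝ) : (Polynomial ℝ)⟦X⟧ :=
  PowerSeries.mk fun n =>
    Polynomial.C (V ^ n / n.factorial) * (1 - Polynomial.X) ^ n.choose 2

theorem constantCoeff_gasSeries (V : ℝ) : constantCoeff (gasSeries V) = 1 := by
  rw [← coeff_zero_eq_constantCoeff_apply, gasSeries, coeff_mk]
  simp

theorem gasSeries_ne_zero (V : ℝ) : gasSeries V ≠ 0 := fun h => by
  simpa [h] using constantCoeff_gasSeries V

/-- The derivation `(1 - y) d/dy`, that is, the derivative with respect to `t / |Λ|`. -/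
def evolution : Derivation ℝ (Polynomial ℝ) (Polynomial ℝ) :=
  ((1 : Polynomial ℝ) - Polynomial.X) • Polynomial.derivative'

theorem evolution_apply (p : Polynomial ℝ) :
    evolution p = (1 - Polynomial.X) * p.derivative := by
  simp [evolution, Polynomial.derivative']

/-- `evolution` multiplies `(1 - y)^(n choose 2)` by `-(n choose 2)`, while `X² d²/dX²` multiplies
`Xⁿ` by `n (n - 1)`, twice as much in absolute value. -/
theorem two_mul_coeffDerivation_gasSeries (V : ℝ) :
    2 * coeffDerivation evolution (gasSeries V) =
      -(X ^ 2 * d⁄dX _ (d⁄dX _ (gasSeries V))) := by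
  have h2 : (2 : (Polynomial ℝ)⟦X⟧) = C 2 := (map_ofNat C 2).symm
  have hcoeff : ∀ n, evolution (coeff n (gasSeries V)) =
      -((n.choose 2 : ℕ) : Polynomial ℝ) * coeff n (gasSeries V) := by
    intro n
    rw [gasSeries, coeff_mk, evolution_apply, Polynomial.derivative_C_mul,
      Polynomial.derivative_pow]
    rcases h : n.choose 2 with _ | k
    · simp
    · simp only [Polynomial.derivative_sub, Polynomial.derivative_one, Polynomial.derivative_X,
        Nat.add_sub_cancel, map_natCast]
      ring
  ext1 n
  rw [h2, coeff_C_mul, coeff_coeffDerivation, hcoeff, map_neg, pow_two, mul_assoc]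
  rcases n with _ | _ | n
  · simp
  · rw [coeff_succ_X_mul]
    simp
  · rw [coeff_succ_X_mul, coeff_succ_X_mul, coeff_derivative, coeff_derivative]
    have hc : 2 * (((n + 2).choose 2 : ℕ) : Polynomial ℝ) = (n + 2) * (n + 1) := by
      have h' : 2 * (n + 2).choose 2 = (n + 2) * (n + 1) := by
        rw [Nat.choose_two_right, Nat.mul_div_cancel' (Nat.even_mul_pred_self _).two_dvd]
        rfl
      exact_mod_cast h'
    push_cast
    linear_combination (-coeff (n + 2) (gasSeries V)) * hc

/-- The density series of the uniformly repulsive gas, over polynomials in `y = 1 - η`. -/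
def gasDensity (V : ℝ) : (Polynomial ℝ)⟦X⟧ :=
  C (Polynomial.C V⁻¹) * (X * d⁄dX _ (gasSeries V)) * invOfUnit (gasSeries V) 1

theorem gasDensity_mul {V : ℝ} (hV : V ≠ 0) :
    C (Polynomial.C V) * gasDensity V * gasSeries V = X * d⁄dX _ (gasSeries V) := by
  have h1 : gasSeries V * invOfUnit (gasSeries V) 1 = 1 :=
    mul_invOfUnit _ _ (by simp [constantCoeff_gasSeries])
  have h2 : (C (Polynomial.C V) : (Polynomial ℝ)⟦X⟧) * C (Polynomial.C V⁻¹) = 1 := by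
    rw [← map_mul, ← map_mul, mul_inv_cancel₀ hV, map_one, map_one]
  rw [gasDensity]
  linear_combination (X * d⁄dX _ (gasSeries V)) * h2 + C (Polynomial.C V) *
    C (Polynomial.C V⁻¹) * X * d⁄dX _ (gasSeries V) * h1

theorem constantCoeff_gasDensity (V : ℝ) : constantCoeff (gasDensity V) = 0 := by
  simp [gasDensity]

theorem coeff_one_gasDensity {V : ℝ} (hV : V ≠ 0) : coeff 1 (gasDensity V) = 1 := by
  rw [gasDensity, mul_assoc, mul_assoc, coeff_C_mul, ← zero_add 1, coeff_succ_X_mul,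
    coeff_zero_eq_constantCoeff_apply, map_mul, constantCoeff_invOfUnit,
    ← coeff_zero_eq_constantCoeff_apply, coeff_derivative, gasSeries, coeff_mk]
  simp [← map_mul, hV]

theorem C_C_ne_zero {V : ℝ} (hV : V ≠ 0) : (C (Polynomial.C V) : (Polynomial ℝ)⟦X⟧) ≠ 0 := by
  rw [Ne, map_eq_zero_iff C C_injective, Polynomial.C_eq_zero]
  exact hV

/-- The formal inverse of the density series. -/
def gasActivity {V : ℝ} (hV : V ≠ 0) : (Polynomial ℝ)⟦X⟧ :=
  substInvOfIsUnit (gasDensity V) (by rw [coeff_one_gasDensity hV]; exact isUnit_one)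

theorem constantCoeff_gasActivity {V : ℝ} (hV : V ≠ 0) : constantCoeff (gasActivity hV) = 0 :=
  constantCoeff_substInvOfIsUnit _ _

theorem isUnit_coeff_one_gasActivity {V : ℝ} (hV : V ≠ 0) : IsUnit (coeff 1 (gasActivity hV)) := by
  rw [gasActivity, coeff_one_substInvOfIsUnit]
  exact Units.isUnit _

theorem gasDensity_subst {V : ℝ} (hV : V ≠ 0) : (gasDensity V).subst (gasActivity hV) = X :=
  subst_substInvOfIsUnit_right _ (constantCoeff_gasDensity V) _

theorem gasActivity_subst {V : ℝ} (hV : V ≠ 0) : (gasActivity hV).subst (gasDensity V) = X :=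
  subst_substInvOfIsUnit_left _ (constantCoeff_gasDensity V) _

theorem constantCoeff_virialDerivative {A : Type*} [CommRing A] {Z u : A⟦X⟧}
    (hZ : constantCoeff Z = 0) (hZ1 : IsUnit (coeff 1 Z)) (hu : X * d⁄dX A Z = u * Z) :
    constantCoeff u = 1 := by
  obtain ⟨E, rfl⟩ := X_dvd_iff.2 hZ
  rw [← zero_add 1, coeff_succ_X_mul, coeff_zero_eq_constantCoeff_apply] at hZ1
  have h1 := congrArg (coeff 1) hu
  rw [← mul_assoc, mul_comm u X, mul_assoc, ← zero_add 1, coeff_succ_X_mul, coeff_succ_X_mul,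
    coeff_derivative, zero_add, ← zero_add 1, coeff_succ_X_mul, coeff_zero_eq_constantCoeff_apply,
    coeff_zero_eq_constantCoeff_apply, map_mul] at h1
  exact hZ1.mul_right_cancel (by rw [← h1]; simp)

theorem map_subst_of_constantCoeff_zero {A B : Type*} [CommRing A] [CommRing B] (φ : A →+* B)
    {Z : A⟦X⟧} (hZ : constantCoeff Z = 0) (f : A⟦X⟧) :
    PowerSeries.map φ (f.subst Z) = (PowerSeries.map φ f).subst (PowerSeries.map φ Z) :=
  PowerSeries.map_subst (HasSubst.of_constantCoeff_zero' hZ) f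

theorem map_derivative {A B : Type*} [CommRing A] [CommRing B] (φ : A →+* B) (f : A⟦X⟧) :
    PowerSeries.map φ (d⁄dX A f) = d⁄dX B (PowerSeries.map φ f) := by
  ext n
  simp [coeff_derivative]

/-- The ideal gas `y = 0`: the partition function solves `F' = V F`, so density and activity
coincide. This is the initial condition of the flow. -/
theorem map_gasDensity_zero {V : ℝ} (hV : V ≠ 0) :
    PowerSeries.map (Polynomial.evalRingHom 0) (gasDensity V) = X := by
  set φ := Polynomial.evalRingHom (0 : ℝ)
  have hder : d⁄dX ℝ (PowerSeries.map φ (gasSeries V)) =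
      C V * PowerSeries.map φ (gasSeries V) := by
    ext n
    rw [coeff_derivative, coeff_C_mul, coeff_map, coeff_map, gasSeries, coeff_mk, coeff_mk]
    simp only [φ, Polynomial.coe_evalRingHom, Polynomial.eval_mul, Polynomial.eval_C,
      Polynomial.eval_pow, Polynomial.eval_sub, Polynomial.eval_one, Polynomial.eval_X, sub_zero,
      one_pow, mul_one]
    rw [Nat.factorial_succ]
    push_cast
    field_simp
    ring
  have h := congrArg (PowerSeries.map φ) (gasDensity_mul hV)
  rw [map_mul, map_mul, map_mul, map_derivative, hder, map_C, map_X] at h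
  have hF : PowerSeries.map φ (gasSeries V) ≠ 0 := fun h0 => by
    have h1 := constantCoeff_gasSeries V
    have h2 := congrArg (coeff 0) h0
    rw [← coeff_zero_eq_constantCoeff_apply] at h1
    rw [coeff_map, h1] at h2
    simp at h2
  have hv : (C V : ℝ⟦X⟧) ≠ 0 := by simpa using hV
  have hφ : φ (Polynomial.C V) = V := by simp [φ]
  rw [hφ] at h
  refine mul_left_cancel₀ (mul_ne_zero hv hF) ?_
  linear_combination h

/-- The derivative `u` of the virial series and the bounds on its coefficients. -/
theorem exists_gas_virialDerivative {V : ℝ} (hV : 0 < V) :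
    ∃ u : (Polynomial ℝ)⟦X⟧,
      X * d⁄dX _ (gasActivity hV.ne') = u * gasActivity hV.ne' ∧
      ∀ n y, 0 ≤ y → y < 1 → |(coeff n u).eval y| ≤
        (if n = 0 then 1 else 0) + (V * y) ^ n * (virialMajorant n).eval y := by
  have hZ0 := constantCoeff_gasActivity hV.ne'
  have hv0 := C_C_ne_zero hV.ne'
  obtain ⟨u, k, hu, huk⟩ := exists_virialDerivative hZ0 (isUnit_coeff_one_gasActivity hV.ne')
  have hδv : coeffDerivation evolution (C (Polynomial.C V)) = 0 := by
    rw [coeffDerivation_C, evolution_apply, Polynomial.derivative_C, mul_zero, map_zero]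
  have hδρ := two_mul_coeffDerivation_density evolution (gasSeries_ne_zero V) hv0 hδv
    derivative_C (two_mul_coeffDerivation_gasSeries V) (gasDensity_mul hV.ne')
  have hδu := two_mul_coeffDerivation_virialDerivative evolution hZ0 (gasDensity_subst hV.ne')
    derivative_C (subst_C _) hδρ hu huk
  have hu0 : coeff 0 u = 1 :=
    (coeff_zero_eq_constantCoeff_apply u).trans <|
      constantCoeff_virialDerivative hZ0 (isUnit_coeff_one_gasActivity hV.ne') hu
  have hinit : PowerSeries.map (Polynomial.evalRingHom 0) u = 1 := by
    set φ := Polynomial.evalRingHom (0 : ℝ)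
    have h1 := congrArg (PowerSeries.map φ) (gasDensity_subst hV.ne')
    rw [map_subst_of_constantCoeff_zero φ hZ0, map_gasDensity_zero hV.ne', map_X, subst_X] at h1
    · have h2 := congrArg (PowerSeries.map φ) hu
      rw [map_mul, map_mul, map_derivative, h1, derivative_X, map_X] at h2
      exact mul_right_cancel₀ X_ne_zero (by rw [← h2]; ring)
    · refine HasSubst.of_constantCoeff_zero' ?_
      rw [← coeff_zero_eq_constantCoeff_apply, coeff_map, coeff_zero_eq_constantCoeff_apply, hZ0,
        map_zero]
  refine ⟨u, hu, fun n y hy0 hy1 => ?_⟩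
  have hbound := virial_coeff_le_majorant hV.le (ξ := u - 1) (S := u + k - 2)
    (by linear_combination huk)
    (by rw [map_sub, hu0, coeff_zero_one, sub_self]) (fun n => ?_) (fun n hn => ?_) n y hy0 hy1
  · have h := hbound.1
    rw [map_sub, Polynomial.eval_sub, coeff_one] at h
    have h3 := abs_sub_abs_le_abs_sub ((coeff n u).eval y)
      ((if n = 0 then 1 else 0 : Polynomial ℝ).eval y)
    have h4 : |((if n = 0 then 1 else 0 : Polynomial ℝ).eval y)| = if n = 0 then 1 else 0 := by
      split_ifs <;> simp
    rw [h4] at h3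
    linarith
  · have h := congrArg (coeff n) hinit
    rw [coeff_map] at h
    rw [map_sub, Polynomial.eval_sub]
    simp only [Polynomial.coe_evalRingHom] at h
    rw [h, coeff_one, coeff_one]
    split_ifs <;> simp
  · obtain ⟨m, rfl⟩ : ∃ m, n = m + 1 := ⟨n - 1, by omega⟩
    have h := congrArg (coeff (m + 1)) hδu
    have h2 : (2 : (Polynomial ℝ)⟦X⟧) = C 2 := (map_ofNat C 2).symm
    rw [h2, coeff_C_mul, coeff_coeffDerivation, evolution_apply, coeff_succ_X_mul, map_add,
      coeff_derivative, coeff_derivative, coeff_succ_X_mul, ← map_mul, coeff_C] at h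
    have h1 : coeff (m + 1) (1 : (Polynomial ℝ)⟦X⟧) = 0 := by simp [coeff_one]
    have h5 : coeff (m + 1) (u + k - 2) - coeff (m + 1) (u - 1) = coeff (m + 1) k := by
      rw [← map_sub, show u + k - 2 - (u - 1) = k - 1 by ring, map_sub, h1, sub_zero]
    rw [h5, map_sub, h1, sub_zero, h]
    simp only [Nat.add_eq_right]
    push_cast
    ring

end GasSeries

/-! ### From the particle system to the formal series -/

section Gas

theorem energy_pairPotential {d n : ℕ} (Λ : Set (E d)) (t : ℝ) (x : Fin n → E d) :
    energy (pairPotential Λ t) x = n.choose 2 * (t / volume.real Λ) := by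
  have h : ∑ i : Fin n, (n - 1 - (i : ℕ)) = n.choose 2 := by
    rw [Fin.sum_univ_eq_sum_range (fun i => n - 1 - i) n, Finset.sum_range_reflect (fun i => i) n,
      Finset.sum_range_id, Nat.choose_two_right]
  unfold energy pairPotential
  simp only [Finset.sum_const, Fin.card_Ioi, nsmul_eq_mul]
  rw [← Finset.sum_mul, ← Nat.cast_sum, h]

theorem canonicalPartition_pairPotential {d : ℕ} (Λ : Set (E d)) (t : ℝ) (n : ℕ) :
    canonicalPartition Λ (pairPotential Λ t) n =
      volume.real Λ ^ n / n.factorial * eta (volume.real Λ) t ^ n.choose 2 := by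
  have hvol : volume.real (Set.univ.pi fun _ : Fin n => Λ) = volume.real Λ ^ n := by
    rw [Measure.real, volume_pi_pi, ENNReal.toReal_prod, Finset.prod_const, Finset.card_univ,
      Fintype.card_fin, Measure.real]
  unfold canonicalPartition
  simp only [energy_pairPotential]
  rw [setIntegral_const, hvol, smul_eq_mul, eta, ← Real.exp_nat_mul]
  rw [mul_neg, div_eq_inv_mul (_ ^ n), mul_assoc]

theorem grandPartition_eq_map {d : ℕ} (Λ : Set (E d)) (t : ℝ) :
    grandPartition Λ (pairPotential Λ t) =
      PowerSeries.map (Polynomial.evalRingHom (1 - eta (volume.real Λ) t))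
        (gasSeries (volume.real Λ)) := by
  ext n
  rw [grandPartition, coeff_mk, coeff_map, gasSeries, coeff_mk, canonicalPartition_pairPotential]
  simp

theorem mul_derivative_logOf {f : ℝ⟦X⟧} (hf : constantCoeff f = 1) :
    f * d⁄dX ℝ (logOf f) = d⁄dX ℝ f := by
  have hs : HasSubst (f - 1) := HasSubst.of_constantCoeff_zero' (by simp [hf])
  have hlog : d⁄dX ℝ (PowerSeries.log ℝ) * (1 + X) = 1 := by
    rw [deriv_log, mul_add, mul_one]
    ext n
    rcases n with _ | n
    · simp
    · rw [map_add, coeff_succ_mul_X, coeff_mk, coeff_mk, coeff_one]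
      simp [pow_succ]
  have h := congrArg (PowerSeries.subst (f - 1)) hlog
  have h1 : (1 : ℝ⟦X⟧).subst (f - 1) = (1 : ℝ⟦X⟧) := by rw [← coe_substAlgHom hs, map_one]
  rw [subst_mul hs, subst_add hs, subst_X hs, h1] at h
  rw [logOf_eq, derivative_subst hs, map_sub, Derivation.map_one_eq_zero, sub_zero]
  linear_combination d⁄dX ℝ f * h

theorem constantCoeff_grandPartition {d : ℕ} (Λ : Set (E d)) (t : ℝ) :
    constantCoeff (grandPartition Λ (pairPotential Λ t)) = 1 := by
  rw [← coeff_zero_eq_constantCoeff_apply, grandPartition, coeff_mk,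
    canonicalPartition_pairPotential]
  simp

theorem densitySeries_eq_map {d : ℕ} (Λ : Set (E d)) (t : ℝ) (hV : volume.real Λ ≠ 0) :
    densitySeries Λ (pairPotential Λ t) =
      PowerSeries.map (Polynomial.evalRingHom (1 - eta (volume.real Λ) t))
        (gasDensity (volume.real Λ)) := by
  set V := volume.real Λ with hVdef
  set φ := Polynomial.evalRingHom (1 - eta V t) with hφ
  have hG := mul_derivative_logOf (constantCoeff_grandPartition Λ t)
  have h := congrArg (PowerSeries.map φ) (gasDensity_mul hV)
  rw [map_mul, map_mul, map_mul, map_derivative, ← grandPartition_eq_map Λ t, map_C, map_X] at h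
  have hφV : φ (Polynomial.C V) = V := by simp [φ]
  have hv : (C V : ℝ⟦X⟧) * C V⁻¹ = 1 := by rw [← map_mul, mul_inv_cancel₀ hV, map_one]
  have hG0 : grandPartition Λ (pairPotential Λ t) ≠ 0 := fun h0 => by
    simpa [h0] using constantCoeff_grandPartition Λ t
  rw [hφV] at h
  refine mul_left_cancel₀ (mul_ne_zero (left_ne_zero_of_mul_eq_one hv) hG0) ?_
  rw [densitySeries, mayerSeries, Derivation.leibniz, derivative_C, ← hVdef]
  simp only [smul_eq_mul]
  linear_combination X * hG * C V * C V⁻¹ - h +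
    X * d⁄dX ℝ (grandPartition Λ (pairPotential Λ t)) * hv

theorem exists_virialSeries {d : ℕ} (Λ : Set (E d)) (t : ℝ) (hV : 0 < volume.real Λ)
    (ht : 0 ≤ t) :
    ∃ P : ℝ⟦X⟧, IsVirialSeries Λ (pairPotential Λ t) P ∧
      (∀ Q : ℝ⟦X⟧, IsVirialSeries Λ (pairPotential Λ t) Q → Q = P) ∧
      ∀ n : ℕ, ((n : ℝ) + 1) * |coeff (n + 1) P| ≤ (if n = 0 then 1 else 0) +
        lam (volume.real Λ) t ^ n *
          (virialMajorant n).eval (1 - eta (volume.real Λ) t) := by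
  set V := volume.real Λ with hVdef
  set φ := Polynomial.evalRingHom (1 - eta V t) with hφ
  set Z := PowerSeries.map φ (gasActivity hV.ne') with hZ
  have hA0 := constantCoeff_gasActivity hV.ne'
  have hD0 := constantCoeff_gasDensity V
  have hZ0 : constantCoeff Z = 0 := by
    rw [hZ, ← coeff_zero_eq_constantCoeff_apply, coeff_map, coeff_zero_eq_constantCoeff_apply,
      hA0, map_zero]
  have hρ := densitySeries_eq_map Λ t hV.ne'
  have hρ0 : constantCoeff (densitySeries Λ (pairPotential Λ t)) = 0 := by
    simp [densitySeries]
  have hright : (densitySeries Λ (pairPotential Λ t)).subst Z = X := by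
    rw [hρ, hZ, ← map_subst_of_constantCoeff_zero φ hA0, gasDensity_subst, map_X]
  have hleft : Z.subst (densitySeries Λ (pairPotential Λ t)) = X := by
    rw [hρ, hZ, ← map_subst_of_constantCoeff_zero φ hD0, gasActivity_subst, map_X]
  have hsZ : HasSubst Z := HasSubst.of_constantCoeff_zero' hZ0
  refine ⟨(mayerSeries Λ (pairPotential Λ t)).subst Z, ⟨Z, hZ0, hright, rfl⟩, ?_, fun n => ?_⟩
  · rintro Q ⟨W, hW0, hW, rfl⟩
    have hsW : HasSubst W := HasSubst.of_constantCoeff_zero' hW0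
    -- A right inverse of the density series equals its left inverse.
    have hWZ : W = Z := by
      have h := congrArg (PowerSeries.subst W) hleft
      rw [subst_comp_subst_apply (HasSubst.of_constantCoeff_zero' hρ0) hsW, hW, X_subst,
        subst_X hsW] at h
      exact h.symm
    rw [hWZ]
  · obtain ⟨u, hu, hbound⟩ := exists_gas_virialDerivative hV
    have hη : 0 < eta V t := Real.exp_pos _
    have hη1 : eta V t ≤ 1 := Real.exp_le_one_iff.2 (by
      have := div_nonneg ht hV.le
      linarith)
    have hmapu : X * d⁄dX ℝ Z = PowerSeries.map φ u * Z := by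
      have h := congrArg (PowerSeries.map φ) hu
      rwa [map_mul, map_mul, map_derivative, map_X] at h
    have hZne : Z ≠ 0 := fun h0 => by
      have hsub : (0 : ℝ⟦X⟧).subst (densitySeries Λ (pairPotential Λ t)) = (0 : ℝ⟦X⟧) := by
        rw [← coe_substAlgHom (HasSubst.of_constantCoeff_zero' hρ0), map_zero]
      rw [h0, hsub] at hleft
      exact X_ne_zero hleft.symm
    -- `Z ℘'(Z) = X` by the definition of the density, so `Z P' = X Z' = u Z`.
    have hP : d⁄dX ℝ ((mayerSeries Λ (pairPotential Λ t)).subst Z) = PowerSeries.map φ u := by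
      have h1 := hright
      rw [densitySeries, subst_mul hsZ, subst_X hsZ] at h1
      refine mul_left_cancel₀ hZne ?_
      rw [derivative_subst hsZ]
      linear_combination d⁄dX ℝ Z * h1 + hmapu
    have hcoeff := congrArg (coeff n) hP
    rw [coeff_derivative, coeff_map] at hcoeff
    have h := hbound n (1 - eta V t) (by linarith) (by linarith)
    have hφu : φ (coeff n u) = (coeff n u).eval (1 - eta V t) := rfl
    rw [← hφu, ← hcoeff, abs_mul, abs_of_nonneg (by positivity : (0 : ℝ) ≤ n + 1)] at h
    rw [lam]
    linarith

theorem le_radiusOfConvergence {V t : ℝ} (hV : 0 < V) (ht : 0 ≤ t) {P : ℝ⟦X⟧}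
    (hP : ∀ n : ℕ, ((n : ℝ) + 1) * |coeff (n + 1) P| ≤ (if n = 0 then 1 else 0) +
      lam V t ^ n * (virialMajorant n).eval (1 - eta V t)) :
    ENNReal.ofReal (varkappa (eta V t)) / ENNReal.ofReal (lam V t) ≤ radiusOfConvergence P := by
  have hη : 0 < eta V t := Real.exp_pos _
  have hη1 : eta V t ≤ 1 := Real.exp_le_one_iff.2 (by
    have := div_nonneg ht hV.le
    linarith)
  have hlam : 0 ≤ lam V t := mul_nonneg hV.le (by linarith)
  have hκ := varkappa_pos hη.le hη1
  have hnorm : ∀ n, ‖FormalMultilinearSeries.ofScalars ℂ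
      (fun n => ((PowerSeries.coeff n P : ℝ) : ℂ)) n‖ = |coeff n P| := by
    intro n
    rw [FormalMultilinearSeries.ofScalars_norm, Complex.norm_real, Real.norm_eq_abs]
  have hP' : ∀ n : ℕ, |coeff (n + 1) P| ≤ (if n = 0 then 1 else 0) +
      lam V t ^ n * (virialMajorant n).eval (1 - eta V t) := fun n =>
    (le_mul_of_one_le_left (abs_nonneg _) (by linarith [n.cast_nonneg (α := ℝ)])).trans (hP n)
  unfold radiusOfConvergence
  rcases hlam.eq_or_lt with h0 | hpos
  -- `λ = 0` is the ideal gas: coefficients from degree `2` on vanish, and the radius is infinite.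
  · rw [FormalMultilinearSeries.radius_eq_top_of_forall_image_add_eq_zero _ 2]
    · exact le_top
    · intro m
      rw [← norm_eq_zero, hnorm]
      have h := hP' (m + 1)
      rw [← h0, zero_pow (Nat.succ_ne_zero m), if_neg (Nat.succ_ne_zero m), zero_mul,
        zero_add] at h
      exact le_antisymm h (abs_nonneg _)
  · rw [← ENNReal.ofReal_div_of_pos hpos]
    set r := varkappa (eta V t) / lam V t with hr
    have hr0 : 0 ≤ r := div_nonneg hκ.le hlam
    refine FormalMultilinearSeries.le_radius_of_bound _ (|coeff 0 P| + 3 * r) fun n => ?_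
    rw [hnorm, Real.coe_toNNReal _ hr0]
    rcases n with _ | n
    · rw [pow_zero, mul_one]
      linarith
    · have h1 : (if n = 0 then 1 else 0 : ℝ) * r ^ n ≤ 1 := by
        split_ifs with hn <;> simp [hn]
      have h2 : lam V t ^ n * (virialMajorant n).eval (1 - eta V t) * r ^ n ≤ 2 := by
        have h := virialMajorant_mul_varkappa_pow_le hη.le hη1 n
        rwa [hr, div_pow, mul_comm (lam V t ^ n), mul_assoc,
          mul_div_cancel₀ _ (pow_ne_zero n hpos.ne')]
      have h3 : |coeff (n + 1) P| * r ^ n ≤ 3 := by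
        have h := mul_le_mul_of_nonneg_right (hP' n) (pow_nonneg hr0 n)
        rw [add_mul] at h
        linarith
      -- The bound controls degree `n + 1` by the `n`-th power of `λ`, hence the extra factor `r`.
      calc |coeff (n + 1) P| * r ^ (n + 1) = |coeff (n + 1) P| * r ^ n * r := by ring
        _ ≤ 3 * r := mul_le_mul_of_nonneg_right h3 hr0
        _ ≤ |coeff 0 P| + 3 * r := by linarith [abs_nonneg (coeff 0 P)]

theorem integral_abs_mayer_pairPotential {d : ℕ} (Λ : Set (E d)) {t : ℝ} (ht : 0 ≤ t) :
    ∫ y in Λ, |Real.exp (-pairPotential Λ t y) - 1| = lam (volume.real Λ) t := by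
  have h : Real.exp (-(t / volume.real Λ)) ≤ 1 :=
    Real.exp_le_one_iff.2 (neg_nonpos.2 (div_nonneg ht measureReal_nonneg))
  simp only [pairPotential]
  rw [setIntegral_const, smul_eq_mul, abs_of_nonpos (by linarith), neg_sub, lam, eta]

end Gas

end RepulsiveGas

end

/-! ### The main theorem -/

theorem mainTheorem2 (d : ℕ) (Λ : Set (RepulsiveGas.E d)) (hΛ : MeasurableSet Λ)
    (hΛ_pos : volume Λ ≠ 0) (hΛ_fin : volume Λ ≠ ⊤) (t : ℝ) (ht : 0 ≤ t) :
    (∃ P : PowerSeries ℝ,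
      RepulsiveGas.IsVirialSeries Λ (RepulsiveGas.pairPotential Λ t) P ∧
      (∀ Q : PowerSeries ℝ,
        RepulsiveGas.IsVirialSeries Λ (RepulsiveGas.pairPotential Λ t) Q → Q = P) ∧
      ENNReal.ofReal (RepulsiveGas.varkappa (RepulsiveGas.eta (volume.real Λ) t)) /
          ENNReal.ofReal (RepulsiveGas.lam (volume.real Λ) t) ≤
        RepulsiveGas.radiusOfConvergence P) ∧
    (0 < t →
      RepulsiveGas.lebowitzPenroseBound Λ (RepulsiveGas.pairPotential Λ t) <
        RepulsiveGas.varkappa (RepulsiveGas.eta (volume.real Λ) t) /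
          RepulsiveGas.lam (volume.real Λ) t ∧
      0.144767 / RepulsiveGas.lam (volume.real Λ) t <
        RepulsiveGas.varkappa (RepulsiveGas.eta (volume.real Λ) t) /
          RepulsiveGas.lam (volume.real Λ) t ∧
      (t / volume.real Λ ≤ 0.00538 →
        0.278465 / RepulsiveGas.lam (volume.real Λ) t <
          RepulsiveGas.varkappa (RepulsiveGas.eta (volume.real Λ) t) /
            RepulsiveGas.lam (volume.real Λ) t)) := by
  set V := volume.real Λ with hVdef
  have hV : 0 < V := ENNReal.toReal_pos hΛ_pos hΛ_fin
  refine ⟨?_, fun htpos => ?_⟩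
  · obtain ⟨P, hP, huniq, hbound⟩ := RepulsiveGas.exists_virialSeries Λ t hV ht
    exact ⟨P, hP, huniq, RepulsiveGas.le_radiusOfConvergence hV ht hbound⟩
  have hs : 0 < t / V := div_pos htpos hV
  have hη : 0 < RepulsiveGas.eta V t := Real.exp_pos _
  have hη1 : RepulsiveGas.eta V t < 1 := Real.exp_lt_one_iff.2 (neg_neg_of_pos hs)
  have hlam : 0 < RepulsiveGas.lam V t := mul_pos hV (by linarith)
  have hκ := RepulsiveGas.le_varkappa hη.le hη1.le
  have hc := RepulsiveGas.sqrt_two_lt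
  refine ⟨?_, div_lt_div_of_pos_right (by linarith) hlam, fun hsmall =>
    div_lt_div_of_pos_right (RepulsiveGas.lt_varkappa_of_small hs.le hsmall) hlam⟩
  rw [RepulsiveGas.lebowitzPenroseBound,
    RepulsiveGas.integral_abs_mayer_pairPotential Λ htpos.le]
  have hsup := RepulsiveGas.lebowitzPenrose_sup_le
  exact div_lt_div_of_pos_right (by linarith) hlam
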